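/- Let $\mathbb{D}=\{z\in\mathbb{C}:|z|<1\}$ and let $\mathrm{Har}(\mathbb{D})$ be the space of complex valued harmonic functions $f$ on $\mathbb{D}$ with $|f|\le 1$, endowed with the topology of uniform convergence on compact subsets of $\mathbb{D}$; this topology is metrizable. The group $PSL(2,\mathbb{R})$ acts on the upper half-plane $\mathbb{H}$ by $z\mapsto (az+b)/(cz+d)$, hence on $\mathbb{D}$ via the conformal isomorphism $\mathbb{D}\to\mathbb{H}$, $z\mapsto i(1-z)/(1+z)$, and it acts on $\mathrm{Har}(\mathbb{D})$ by $\gamma\cdot f=f\circ\gamma^{-1}$. A continuous map $T:X\to X$ of a metric space $(X,d)$ is called chaotic in the sense of Devaney if 1. (topological transitivity) for all nonempty open sets $U,V\subseteq X$ there is an integer $n>0$ with $T^n(U)\cap V\neq\emptyset$; 2. the set of periodic points, i.e. of the $x\in X$ with $T^n(x)=x$ for some $n>0$, is dense in $X$; 3. (sensitive dependence on initial conditions) there is $\delta>0$ such that for every $x\in X$ and every neighborhood $N$ of $x$ there are $y\in N$ and an integer $n>0$ with $d(T^n(x),T^n(y))>\delta$. **Theorem.** Let $\gamma\in PSL(2,\mathbb{R})$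 be hyperbolic (represented by a matrix in $SL(2,\mathbb{R})$ with two distinct real eigenvalues) or parabolic (represented by a non-scalar matrix in $SL(2,\mathbb{R})$ with exactly one eigenvalue). Then, for every metric on $\mathrm{Har}(\mathbb{D})$ inducing the topology of uniform convergence on compact sets, the transformation $f\mapsto\gamma\cdot f$ of $\mathrm{Har}(\mathbb{D})$ is continuous and chaotic in the sense of Devaney. -/

import Mathlib

open Complex Metric InnerProductSpace
open scoped MatrixGroups Complex.UnitDisc UpperHalfPlane ComplexConjugate

noncomputable section

namespace HarDisc

/-! ### The action of `PSL(2, ℝ)` on the unit disc -/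

/-- The inverse `w ↦ (i - w) / (i + w)` of the Cayley transform lands in the unit disc. -/
theorem norm_cayleyInv_lt_one (w : ℍ) : ‖(I - (w : ℂ)) / (I + w)‖ < 1 := by
  have h : 0 < (w : ℂ).im := w.im_pos
  have hne : I + (w : ℂ) ≠ 0 := fun h0 => by
    have := congrArg Complex.im h0
    simp at this
    linarith [w.im_pos]
  rw [norm_div, div_lt_one (norm_pos_iff.2 hne), ← sq_lt_sq₀ (norm_nonneg _) (norm_nonneg _),
    Complex.sq_norm, Complex.sq_norm, Complex.normSq_apply, Complex.normSq_apply]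
  simp only [sub_re, sub_im, add_re, add_im, I_re, I_im]
  nlinarith

/-- The Cayley transform `z ↦ i (1 - z) / (1 + z)` maps the unit disc to the upper half-plane. -/
theorem cayley_im_pos (z : 𝔻) : 0 < (I * (1 - (z : ℂ)) / (1 + z)).im := by
  have hne : 1 + (z : ℂ) ≠ 0 := z.one_add_coe_ne_zero
  have hz : normSq (z : ℂ) < 1 := z.normSq_lt_one
  rw [Complex.normSq_apply] at hz
  have h : (I * (1 - (z : ℂ)) / (1 + z)).im = (1 - normSq (z : ℂ)) / normSq (1 + (z : ℂ)) := by
    rw [Complex.div_im, ← sub_div, Complex.normSq_apply (z : ℂ)]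
    congr 1
    simp
    ring
  rw [h]
  refine div_pos ?_ (normSq_pos.2 hne)
  rw [Complex.normSq_apply]
  linarith

/-- The conformal isomorphism `z ↦ i (1 - z) / (1 + z)` from the unit disc onto the upper
half-plane. -/
def cayley : 𝔻 ≃ ℍ where
  toFun z := ⟨I * (1 - (z : ℂ)) / (1 + z), cayley_im_pos z⟩
  invFun w := UnitDisc.mk ((I - (w : ℂ)) / (I + w)) (norm_cayleyInv_lt_one w)
  left_inv z := by
    have hne : 1 + (z : ℂ) ≠ 0 := z.one_add_coe_ne_zero
    apply UnitDisc.coe_injective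
    rw [UnitDisc.coe_mk]
    change (I - I * (1 - (z : ℂ)) / (1 + z)) / (I + I * (1 - (z : ℂ)) / (1 + z)) = z
    have h1 : I - I * (1 - (z : ℂ)) / (1 + z) = 2 * I * z / (1 + z) := by field_simp; ring
    have h2 : I + I * (1 - (z : ℂ)) / (1 + z) = 2 * I / (1 + z) := by field_simp; ring
    rw [h1, h2]
    field_simp
  right_inv w := by
    have hne : I + (w : ℂ) ≠ 0 := fun h0 => by
      have := congrArg Complex.im h0
      simp at this
      linarith [w.im_pos]
    apply UpperHalfPlane.ext
    change I * (1 - (I - (w : ℂ)) / (I + w)) / (1 + (I - (w : ℂ)) / (I + w)) = w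
    have h1 : 1 - (I - (w : ℂ)) / (I + w) = 2 * w / (I + w) := by field_simp; ring
    have h2 : 1 + (I - (w : ℂ)) / (I + w) = 2 * I / (I + w) := by field_simp; ring
    rw [h1, h2]
    field_simp

/-- `PSL(2, ℝ)` acts on the unit disc: the action on the upper half-plane by fractional linear
transformations, transported by the Cayley transform. -/
instance : MulAction PSL(2, ℝ) 𝔻 where
  smul γ z := cayley.symm (Matrix.ProjectiveSpecialLinearGroup.toPGL γ • cayley z)
  one_smul z := by
    change cayley.symm (Matrix.ProjectiveSpecialLinearGroup.toPGL (1 : PSL(2, ℝ)) • cayley z) = z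
    rw [map_one, one_smul, Equiv.symm_apply_apply]
  mul_smul γ γ' z := by
    change cayley.symm (Matrix.ProjectiveSpecialLinearGroup.toPGL (γ * γ') • cayley z) =
      cayley.symm (Matrix.ProjectiveSpecialLinearGroup.toPGL γ • cayley (cayley.symm
        (Matrix.ProjectiveSpecialLinearGroup.toPGL γ' • cayley z)))
    rw [map_mul, mul_smul, Equiv.apply_symm_apply]

theorem smul_def (γ : PSL(2, ℝ)) (z : 𝔻) :
    γ • z = cayley.symm (Matrix.ProjectiveSpecialLinearGroup.toPGL γ • cayley z) := rfl

/-- The coefficient `α = ((a + d) + (b - c) i) / 2`. -/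
def coeffα (g : SL(2, ℝ)) : ℂ := ((g 0 0 + g 1 1 : ℝ) + (g 0 1 - g 1 0 : ℝ) * I) / 2

/-- The coefficient `β = ((d - a) + (b + c) i) / 2`. -/
def coeffβ (g : SL(2, ℝ)) : ℂ := ((g 1 1 - g 0 0 : ℝ) + (g 0 1 + g 1 0 : ℝ) * I) / 2

theorem normSq_coeff (g : SL(2, ℝ)) : normSq (coeffα g) - normSq (coeffβ g) = 1 := by
  have hdet : g 0 0 * g 1 1 - g 0 1 * g 1 0 = 1 := by
    rw [← Matrix.det_fin_two, g.det_coe]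
  simp only [coeffα, coeffβ, Complex.normSq_apply, div_ofNat_re, div_ofNat_im, add_re, add_im,
    ofReal_re, ofReal_im, mul_re, mul_im, I_re, I_im]
  linear_combination hdet

theorem disc_denom_ne_zero (g : SL(2, ℝ)) {z : ℂ} (hz : ‖z‖ < 1) :
    conj (coeffβ g) * z + conj (coeffα g) ≠ 0 := by
  intro h
  have h1 : conj (coeffα g) = -(conj (coeffβ g) * z) := by linear_combination h
  have h2 := congrArg norm h1
  rw [norm_neg, norm_mul, RCLike.norm_conj, RCLike.norm_conj] at h2
  have h3 := normSq_coeff g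
  rw [Complex.normSq_eq_norm_sq, Complex.normSq_eq_norm_sq, h2] at h3
  have h4 : ‖z‖ ^ 2 ≤ 1 := by nlinarith [norm_nonneg z]
  nlinarith [sq_nonneg ‖coeffβ g‖]

theorem moebius_identity {a b c d W Z : ℂ} (hcd : c * W + d ≠ 0) (hZ : 1 + Z ≠ 0)
    (hW : W * (1 + Z) = I * (1 - Z)) :
    (I - (a * W + b) / (c * W + d)) *
        (((d - a) - (b + c) * I) / 2 * Z + ((a + d) - (b - c) * I) / 2) =
      (((a + d) + (b - c) * I) / 2 * Z + ((d - a) + (b + c) * I) / 2) *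
        (I + (a * W + b) / (c * W + d)) := by
  have hI : I ^ 2 = -1 := I_sq
  have h1 : I - (a * W + b) / (c * W + d) = (I * (c * W + d) - (a * W + b)) / (c * W + d) := by
    rw [sub_div, mul_div_cancel_right₀ _ hcd]
  have h2 : I + (a * W + b) / (c * W + d) = (I * (c * W + d) + (a * W + b)) / (c * W + d) := by
    rw [add_div (I * (c * W + d)), mul_div_cancel_right₀ _ hcd]
  rw [h1, h2, div_mul_eq_mul_div, mul_div_assoc']
  congr 1
  refine mul_right_cancel₀ hZ ?_
  clear h1 h2 hcd hZ
  generalize I = i at *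
  grind

/-- On the disc, the class of `g = (a b; c d)` acts by `z ↦ (α z + β) / (β̄ z + ᾱ)`. -/
theorem coe_mk_smul (g : SL(2, ℝ)) (z : 𝔻) :
    (((g : PSL(2, ℝ)) • z : 𝔻) : ℂ) =
      (coeffα g * z + coeffβ g) / (conj (coeffβ g) * z + conj (coeffα g)) := by
  have hd := disc_denom_ne_zero g z.norm_lt_one
  have hne : 1 + (z : ℂ) ≠ 0 := z.one_add_coe_ne_zero
  set w : ℍ := cayley z with hw
  have hwz : (w : ℂ) = I * (1 - (z : ℂ)) / (1 + z) := rfl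
  have hgw : ((g • w : ℍ) : ℂ) = (g 0 0 * w + g 0 1) / (g 1 0 * w + g 1 1) :=
    UpperHalfPlane.coe_specialLinearGroup_apply g w
  have hcd : (g 1 0 : ℂ) * w + g 1 1 ≠ 0 := UpperHalfPlane.denom_ne_zero (g : GL (Fin 2) ℝ) w
  have hsmul : (((g : PSL(2, ℝ)) • z : 𝔻) : ℂ) =
      (I - ((g • w : ℍ) : ℂ)) / (I + ((g • w : ℍ) : ℂ)) := by
    rw [smul_def]
    rfl
  have hI : I + ((g • w : ℍ) : ℂ) ≠ 0 := fun h0 => by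
    have := congrArg Complex.im h0
    simp only [add_im, I_im, zero_im] at this
    have h1 : 0 < ((g • w : ℍ) : ℂ).im := (g • w).im_pos
    linarith
  rw [hsmul, div_eq_div_iff hI hd, hgw]
  have e1 : conj (coeffα g) = ((g 0 0 + g 1 1 : ℝ) - (g 0 1 - g 1 0 : ℝ) * I) / 2 := by
    simp only [coeffα, map_div₀, map_add, map_mul, conj_ofReal, conj_I, map_ofNat]
    ring
  have e2 : conj (coeffβ g) = ((g 1 1 - g 0 0 : ℝ) - (g 0 1 + g 1 0 : ℝ) * I) / 2 := by
    simp only [coeffβ, map_div₀, map_add, map_mul, conj_ofReal, conj_I, map_ofNat]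
    ring
  rw [e1, e2, coeffα, coeffβ]
  push_cast
  generalize (g 0 0 : ℂ) = a at *
  generalize (g 0 1 : ℂ) = b at *
  generalize (g 1 0 : ℂ) = c at *
  generalize (g 1 1 : ℂ) = d at *
  have hw2 : (w : ℂ) * (1 + z) = I * (1 - z) := by rw [hwz]; field_simp
  generalize (w : ℂ) = W at *
  generalize (z : ℂ) = Z at *
  exact moebius_identity hcd hne hw2

/-! ### The space of harmonic functions bounded by one -/

/-- Precomposition with an analytic map preserves harmonicity. -/
theorem harmonicAt_comp {f g : ℂ → ℂ} {z : ℂ} (hf : HarmonicAt f (g z)) (hg : AnalyticAt ℂ g z) :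
    HarmonicAt (f ∘ g) z := by
  have key : ∀ u : ℂ → ℝ, HarmonicAt u (g z) → HarmonicAt (u ∘ g) z := by
    intro u hu
    obtain ⟨ε, hε, hball⟩ := Metric.eventually_nhds_iff_ball.1 hu.eventually
    obtain ⟨F, hF, hFu⟩ := InnerProductSpace.HarmonicOnNhd.exists_analyticOnNhd_ball_re_eq
      (f := u) (z := g z) (R := ε) hball
    have h1 : HarmonicAt (fun w => (F (g w)).re) z :=
      ((hF (g z) (mem_ball_self hε)).comp hg).harmonicAt_re
    refine (harmonicAt_congr_nhds ?_).1 h1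
    filter_upwards [hg.continuousAt (ball_mem_nhds (g z) hε)] with w hw
    exact hFu hw
  have hre := (key _ (hf.comp_CLM reCLM)).comp_CLM ofRealCLM
  have him := ((key _ (hf.comp_CLM imCLM)).comp_CLM ofRealCLM).comp_CLM
    ((I • (ContinuousLinearMap.id ℝ ℂ) : ℂ →L[ℝ] ℂ))
  refine (harmonicAt_congr_nhds (Filter.Eventually.of_forall fun w => ?_)).1 (hre.add him)
  apply Complex.ext <;> simp

/-- The space of complex valued harmonic functions `f` on the unit disc with `|f| ≤ 1`.
Harmonicity is a local condition at the points of the disc, so the values outside the disc of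
the extension of `f` to `ℂ` are irrelevant. -/
def Har : Set C(𝔻, ℂ) :=
  {f | HarmonicOnNhd (Function.extend ((↑) : 𝔻 → ℂ) f 0) (ball 0 1) ∧ ∀ z, ‖f z‖ ≤ 1}

/-- The topology of uniform convergence on compact subsets of the disc: the subspace topology
of the compact-open topology on `C(𝔻, ℂ)`. -/
abbrev harTopology : TopologicalSpace Har :=
  TopologicalSpace.induced Subtype.val ContinuousMap.compactOpen

theorem continuous_smul_disc (γ : PSL(2, ℝ)) : Continuous (fun z : 𝔻 => γ • z) := by
  obtain ⟨g, rfl⟩ := QuotientGroup.mk_surjective γ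
  rw [UnitDisc.isEmbedding_coe.continuous_iff]
  have : ((↑) : 𝔻 → ℂ) ∘ (fun z : 𝔻 => (g : PSL(2, ℝ)) • z) = fun z : 𝔻 =>
      (coeffα g * z + coeffβ g) / (conj (coeffβ g) * z + conj (coeffα g)) :=
    funext fun z => coe_mk_smul g z
  rw [this]
  have hc := UnitDisc.continuous_coe
  exact Continuous.div (by fun_prop) (by fun_prop)
    fun z => disc_denom_ne_zero g z.norm_lt_one

/-- The self-homeomorphism of the disc defined by `γ`, as a continuous map. -/
def discMap (γ : PSL(2, ℝ)) : C(𝔻, 𝔻) := ⟨fun z => γ • z, continuous_smul_disc γ⟩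

theorem comp_discMap_mem_Har (γ : PSL(2, ℝ)) {f : C(𝔻, ℂ)} (hf : f ∈ Har) :
    f.comp (discMap γ) ∈ Har := by
  refine ⟨?_, fun z => hf.2 _⟩
  obtain ⟨g, rfl⟩ := QuotientGroup.mk_surjective γ
  intro z hz
  set m : ℂ → ℂ := fun z =>
    (coeffα g * z + coeffβ g) / (conj (coeffβ g) * z + conj (coeffα g)) with hm
  have hinj : Function.Injective ((↑) : 𝔻 → ℂ) := UnitDisc.coe_injective
  have hmz : ∀ w : 𝔻, m w = ((g : PSL(2, ℝ)) • w : 𝔻) := fun w => (coe_mk_smul g w).symm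
  have hz1 : ‖z‖ < 1 := mem_ball_zero_iff.1 hz
  have han : AnalyticAt ℂ m z := by
    refine AnalyticAt.div (by fun_prop) (by fun_prop) (disc_denom_ne_zero g hz1)
  have hmem : m z ∈ ball (0 : ℂ) 1 := by
    have := hmz (UnitDisc.mk z hz1)
    rw [UnitDisc.coe_mk] at this
    rw [this, mem_ball_zero_iff]
    exact UnitDisc.norm_lt_one _
  refine (harmonicAt_congr_nhds ?_).1 (harmonicAt_comp (hf.1 _ hmem) han)
  filter_upwards [isOpen_ball.mem_nhds hz] with w hw
  have hw1 : ‖w‖ < 1 := mem_ball_zero_iff.1 hw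
  have h1 := hmz (UnitDisc.mk w hw1)
  rw [UnitDisc.coe_mk] at h1
  have h2 := hinj.extend_apply (f.comp (discMap (g : PSL(2, ℝ)))) 0 (UnitDisc.mk w hw1)
  rw [UnitDisc.coe_mk] at h2
  erw [h2]
  rw [Function.comp_apply, h1, hinj.extend_apply]
  rfl

/-- `PSL(2, ℝ)` acts on the space of harmonic functions by `γ • f = f ∘ γ⁻¹`. -/
instance : MulAction PSL(2, ℝ) Har where
  smul γ f := ⟨f.1.comp (discMap γ⁻¹), comp_discMap_mem_Har γ⁻¹ f.2⟩
  one_smul f := by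
    apply Subtype.ext
    ext z
    change f.1 ((1 : PSL(2, ℝ))⁻¹ • z) = f.1 z
    rw [inv_one, one_smul]
  mul_smul γ γ' f := by
    apply Subtype.ext
    ext z
    change f.1 ((γ * γ')⁻¹ • z) = f.1 (γ'⁻¹ • γ⁻¹ • z)
    rw [mul_inv_rev, mul_smul]

theorem smul_apply (γ : PSL(2, ℝ)) (f : Har) (z : 𝔻) : (γ • f).1 z = f.1 (γ⁻¹ • z) := rfl

/-- The topology of uniform convergence on compact sets on `Har` is induced by a metric. -/
theorem exists_compatible_metric :
    ∃ m : MetricSpace Har, m.toUniformSpace.toTopologicalSpace = harTopology := by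
  have : LocallyCompactSpace 𝔻 :=
    (isOpen_ball : IsOpen (ball (0 : ℂ) 1)).locallyCompactSpace
  have : SecondCountableTopology 𝔻 :=
    inferInstanceAs (SecondCountableTopology (ball (0 : ℂ) 1))
  exact ⟨TopologicalSpace.metrizableSpaceMetric Har, rfl⟩

/-! ### Hyperbolic and parabolic elements -/

/-- An element of `PSL(2, ℝ)` is hyperbolic if the matrices `±g` representing it are hyperbolic,
i.e. have two distinct real eigenvalues. -/
def IsHyperbolic (γ : PSL(2, ℝ)) : Prop :=
  ∃ g : SL(2, ℝ), (g : PSL(2, ℝ)) = γ ∧ (g : Matrix (Fin 2) (Fin 2) ℝ).IsHyperbolic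

/-- An element of `PSL(2, ℝ)` is parabolic if the matrices `±g` representing it are parabolic,
i.e. are not scalar and have exactly one eigenvalue. -/
def IsParabolic (γ : PSL(2, ℝ)) : Prop :=
  ∃ g : SL(2, ℝ), (g : PSL(2, ℝ)) = γ ∧ (g : Matrix (Fin 2) (Fin 2) ℝ).IsParabolic

/-! ### Chaos -/

/-- `f` has sensitive dependence on initial conditions. -/
def SensitiveDependence {X : Type*} [MetricSpace X] (f : X → X) : Prop :=
  ∃ δ > 0, ∀ x : X, ∀ N ∈ nhds x, ∃ y ∈ N, ∃ n : ℕ, 0 < n ∧ δ < dist (f^[n] x) (f^[n] y)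

/-- A continuous self-map of a metric space is chaotic in the sense of Devaney if it is
topologically transitive, its periodic points are dense, and it has sensitive dependence on
initial conditions. -/
structure IsDevaneyChaotic {X : Type*} [MetricSpace X] (f : X → X) : Prop where
  continuous : Continuous f
  transitive : ∀ U V : Set X, IsOpen U → U.Nonempty → IsOpen V → V.Nonempty →
    ∃ n : ℕ, 0 < n ∧ (f^[n] '' U ∩ V).Nonempty
  dense_periodicPts : Dense (Function.periodicPts f)
  sensitive : SensitiveDependence f

end HarDisc

end

namespace HarDisc

open Filter Topology MeasureTheory

/-! ### Criteria for chaos -/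

/-! The action resembles a shift: after passing to boundary values, a point of a dense set is a
function on the line whose values on many disjoint pieces can be prescribed independently, and `γ`
moves these pieces around.

A hyperbolic or parabolic `γ` fixes a boundary point of the half-plane. Moving it to infinity
(`exists_conj_upperTriangular`) makes `γ⁻¹` act by a nontrivial affine map `w ↦ s w + c` with `s >
0`. Poisson integrals of measurable functions on the line bounded by one are dense in `Har`
(`denseRange_poissonHar`), and there the action is precomposition with `t ↦ s t + c`
(`poissonFun_comp_affine`). In the coordinate `x`, or `log |x - x₀|` with `x₀` the finite fixed
point, this map is a translation. The sets where the coordinate is at most `m` in absolute value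
exhaust the line up to a null set, and all nonzero multiples of a large iterate displace each of
them from itself. `WanderingModel` records this situation.

By dominated convergence, every nonempty open set contains all Poisson integrals whose boundary
function agrees with a suitable `ψ` on a large enough such set. Pasting two boundary functions gives
transitivity, and repeating one periodically gives dense periodic points. Sensitivity for an
arbitrary compatible metric follows from these two properties and two distinct fixed points, the
constants 0 and 1. -/

/-- A topologically transitive continuous map with dense periodic points and two fixed points has
sensitive dependence on initial conditions. -/
theorem sensitiveDependence_of_transitive {X : Type*} [MetricSpace X] {T : X → X}
    (hT : Continuous T)
    (htr : ∀ U V : Set X, IsOpen U → U.Nonempty → IsOpen V → V.Nonempty →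
      ∃ n : ℕ, 0 < n ∧ (T^[n] '' U ∩ V).Nonempty)
    (hper : Dense (Function.periodicPts T)) {q₀ q₁ : X} (h₀ : T q₀ = q₀) (h₁ : T q₁ = q₁)
    (hne : q₀ ≠ q₁) : SensitiveDependence T := by
  have hd : 0 < dist q₀ q₁ := dist_pos.2 hne
  -- With this `η`, one of the two fixed points is at distance at least `4 * η` from any given `x`.
  set η : ℝ := dist q₀ q₁ / 8 with hη
  have hη0 : 0 < η := by positivity
  refine ⟨η, hη0, fun x N hN => ?_⟩
  obtain ⟨q, hq, hxq⟩ : ∃ q, T q = q ∧ 4 * η ≤ dist x q := by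
    by_contra! hcon
    have a0 := hcon q₀ h₀
    have a1 := hcon q₁ h₁
    have := dist_triangle_left q₀ q₁ x
    linarith
  have hqk : ∀ k, T^[k] q = q := fun k => Function.iterate_fixed hq k
  obtain ⟨U, hUN, hU, hxU⟩ := _root_.mem_nhds_iff.1 hN
  obtain ⟨p, ⟨hpU, hpx⟩, n, hn, hpn⟩ := hper.inter_open_nonempty (U ∩ ball x η)
    (hU.inter isOpen_ball) ⟨x, hxU, mem_ball_self hη0⟩
  have hTk : ∀ k, Continuous T^[k] := fun k => hT.iterate k
  -- The orbit of `y` stays near `q` at the times `k, …, k + n`, a window long enough to contain a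
  -- multiple `n * j` of the period of `p`. At that time `p` is back near `x` while `y` is near `q`,
  -- so the orbit of `x` is far from one of the two.
  obtain ⟨k, -, -, ⟨y, ⟨hyU, hyx⟩, rfl⟩, hyV⟩ := htr (U ∩ ball x η)
    (⋂ i ∈ Finset.range (n + 1), T^[i] ⁻¹' ball q η) (hU.inter isOpen_ball)
    ⟨x, hxU, mem_ball_self hη0⟩
    (isOpen_biInter_finset fun i _ => isOpen_ball.preimage (hTk i))
    ⟨q, by simp [hqk, hη0]⟩
  set j := k / n + 1 with hj
  have hle : k ≤ n * j ∧ n * j - k ≤ n ∧ 0 < n * j := by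
    have h1 := Nat.div_add_mod k n
    have h2 := Nat.mod_lt k hn
    have h3 : n * j = n * (k / n) + n := by rw [hj]; ring
    omega
  obtain ⟨hkj, hr, hpos⟩ := hle
  have hy : T^[n * j] y ∈ ball q η := by
    have := Set.mem_iInter₂.1 hyV (n * j - k) (Finset.mem_range.2 (by omega))
    rwa [Set.mem_preimage, ← Function.iterate_add_apply, Nat.sub_add_cancel hkj] at this
  have hp : T^[n * j] p = p := (hpn.mul_const j : _)
  rw [mem_ball] at hy hpx
  rcases lt_or_ge η (dist (T^[n * j] x) (T^[n * j] y)) with h | h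
  · exact ⟨y, hUN hyU, n * j, hpos, h⟩
  · refine ⟨p, hUN hpU, n * j, hpos, ?_⟩
    rw [hp]
    have t1 := dist_triangle x p q
    have t2 := dist_triangle p (T^[n * j] y) q
    have t3 := dist_triangle_left p (T^[n * j] y) (T^[n * j] x)
    rw [dist_comm x p] at t1
    linarith

/-- The measurable complex valued functions bounded by one. -/
abbrev BoundaryFun (Ω : Type*) [MeasurableSpace Ω] : Type _ :=
  {ψ : Ω → ℂ // Measurable ψ ∧ ∀ x, ‖ψ x‖ ≤ 1}

/-- Precomposition of a bounded measurable function with a measurable map. -/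
def BoundaryFun.comp {Ω : Type*} [MeasurableSpace Ω] (ψ : BoundaryFun Ω) {A : Ω → Ω}
    (hA : Measurable A) : BoundaryFun Ω :=
  ⟨ψ.1 ∘ A, ψ.2.1.comp hA, fun x => ψ.2.2 (A x)⟩

/-- A self-map `T` of a topological space is a factor of a flow `A` on a space of boundary points:
functions on the boundary parametrize a dense set, equivariantly and continuously with respect to
pointwise convergence, and the boundary is exhausted by wandering sets. -/
structure WanderingModel {X : Type*} [TopologicalSpace X] (T : X → X) {Ω : Type*}
    [MeasurableSpace Ω] (Q : BoundaryFun Ω → X) (A : ℤ → Ω → Ω) (J : ℕ → Set Ω) : Prop where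
  denseRange : DenseRange Q
  measurable : ∀ k, Measurable (A k)
  zero : ∀ x, A 0 x = x
  add : ∀ j k x, A (j + k) x = A j (A k x)
  equivariant : ∀ ψ, T (Q ψ) = Q (ψ.comp (measurable 1))
  measurableSet : ∀ m, MeasurableSet (J m)
  tendsto : ∀ (φ : ℕ → BoundaryFun Ω) (ψ : BoundaryFun Ω), (∀ m, Set.EqOn (φ m).1 ψ.1 (J m)) →
    Tendsto (fun m => Q (φ m)) atTop (𝓝 (Q ψ))
  mono : Monotone J
  wandering : ∀ m, ∃ N : ℕ, 0 < N ∧ ∀ k : ℤ, k ≠ 0 → ∀ x ∈ J m, A (k * N) x ∉ J m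

namespace WanderingModel

variable {X : Type*} [TopologicalSpace X] {T : X → X} {Ω : Type*} [MeasurableSpace Ω]
  {Q : BoundaryFun Ω → X} {A : ℤ → Ω → Ω} {J : ℕ → Set Ω}

theorem iterate_apply (h : WanderingModel T Q A J) (n : ℕ) (ψ : BoundaryFun Ω) :
    T^[n] (Q ψ) = Q (ψ.comp (h.measurable n)) := by
  induction n generalizing ψ with
  | zero =>
    refine congrArg Q (Subtype.ext (funext fun x => ?_))
    change ψ.1 x = ψ.1 (A (0 : ℕ) x)
    rw [Nat.cast_zero, h.zero]
  | succ n ih =>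
    rw [Function.iterate_succ_apply, h.equivariant, ih]
    congr 1
    refine Subtype.ext (funext fun x => congrArg ψ.1 ?_)
    rw [← h.add]
    congr 1
    push_cast
    ring

/-- Every nonempty open set contains, for all large `m`, the images of all the extensions of a
suitable function on `J m`. -/
theorem exists_forall_eqOn_mem (h : WanderingModel T Q A J) {U : Set X} (hU : IsOpen U)
    (hne : U.Nonempty) :
    ∃ (ψ : BoundaryFun Ω) (m₀ : ℕ), ∀ m ≥ m₀, ∀ φ : BoundaryFun Ω, Set.EqOn φ.1 ψ.1 (J m) →
      Q φ ∈ U := by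
  obtain ⟨ψ, hψ⟩ := h.denseRange.exists_mem_open hU hne
  refine ⟨ψ, ?_⟩
  suffices H : ∃ m₀, ∀ φ : BoundaryFun Ω, Set.EqOn φ.1 ψ.1 (J m₀) → Q φ ∈ U by
    obtain ⟨m₀, H⟩ := H
    exact ⟨m₀, fun m hm φ hφ => H φ (hφ.mono (h.mono hm))⟩
  -- Otherwise one counterexample for each `J m` gives a sequence converging to `Q ψ` while staying
  -- outside `U`.
  by_contra! hcon
  choose φ hφ hφU using hcon
  obtain ⟨m, hm⟩ := ((h.tendsto φ ψ hφ).eventually (hU.mem_nhds hψ)).exists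
  exact hφU m hm

/-- Since `A N` moves `J m` off itself, one boundary function can equal `ψ` on `J m` and, after `N`
steps, equal `φ` on `J m`. -/
theorem transitive (h : WanderingModel T Q A J) {U V : Set X} (hU : IsOpen U) (hUne : U.Nonempty)
    (hV : IsOpen V) (hVne : V.Nonempty) : ∃ n : ℕ, 0 < n ∧ (T^[n] '' U ∩ V).Nonempty := by
  obtain ⟨ψ, m₁, hψ⟩ := h.exists_forall_eqOn_mem hU hUne
  obtain ⟨φ, m₂, hφ⟩ := h.exists_forall_eqOn_mem hV hVne
  set m := max m₁ m₂
  obtain ⟨N, hN, hJ⟩ := h.wandering m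
  classical
  let χ : BoundaryFun Ω := ⟨(J m).piecewise ψ.1 (φ.1 ∘ A (-N)),
    ψ.2.1.piecewise (h.measurableSet m) (φ.2.1.comp (h.measurable _)), fun x => by
      by_cases hx : x ∈ J m
      · rw [Set.piecewise_eq_of_mem _ _ _ hx]
        exact ψ.2.2 x
      · rw [Set.piecewise_eq_of_notMem _ _ _ hx]
        exact φ.2.2 _⟩
  refine ⟨N, hN, _, ⟨Q χ, hψ m (le_max_left _ _) χ fun x hx => Set.piecewise_eq_of_mem _ _ _ hx,
    h.iterate_apply N χ⟩, hφ m (le_max_right _ _) _ fun x hx => ?_⟩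
  have hx' : A N x ∉ J m := by simpa using hJ 1 one_ne_zero x hx
  change (J m).piecewise ψ.1 (φ.1 ∘ A (-N)) (A N x) = φ.1 x
  rw [Set.piecewise_eq_of_notMem _ _ _ hx', Function.comp_apply, ← h.add, neg_add_cancel, h.zero]

/-- The preimages of `J m` under the maps `A (k * N)` are pairwise disjoint, so the restriction of
`ψ` to `J m` extends to a function invariant under `A N`, taken to be zero off their union. -/
theorem dense_periodicPts (h : WanderingModel T Q A J) : Dense (Function.periodicPts T) := by
  rw [dense_iff_inter_open]
  intro U hU hUne
  obtain ⟨ψ, m, hψ⟩ := h.exists_forall_eqOn_mem hU hUne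
  obtain ⟨N, hN, hJ⟩ := h.wandering m
  have huniq : ∀ (x : Ω) (j k : ℤ), A (j * N) x ∈ J m → A (k * N) x ∈ J m → j = k := by
    intro x j k hj hk
    by_contra hne
    refine hJ (k - j) (sub_ne_zero.2 (Ne.symm hne)) _ hj ?_
    rw [← h.add]
    convert hk using 2
    ring
  set S : Set Ω := ⋃ k : ℤ, A (k * N) ⁻¹' J m with hS
  have hSm : MeasurableSet S :=
    MeasurableSet.iUnion fun k => h.measurable _ (h.measurableSet m)
  obtain ⟨f, hf, hfeq⟩ := exists_measurable_piecewise
    (fun k : ℤ => A (k * N) ⁻¹' J m) (fun k => h.measurable _ (h.measurableSet m))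
    (fun k => ψ.1 ∘ A (k * N)) (fun k => ψ.2.1.comp (h.measurable _))
    (fun j k hjk x hx => absurd (huniq x j k hx.1 hx.2) hjk)
  classical
  -- Off `S` nothing is known about `f`; cutting it off restores both the bound and the invariance.
  set g : Ω → ℂ := S.indicator f with hg
  have hgS : ∀ (k : ℤ) (x : Ω), A (k * N) x ∈ J m → g x = ψ.1 (A (k * N) x) := fun k x hx => by
    rw [hg, Set.indicator_of_mem (Set.mem_iUnion.2 ⟨k, hx⟩)]
    exact hfeq k hx
  have hgN : ∀ x : Ω, (∀ k : ℤ, A (k * N) x ∉ J m) → g x = 0 := fun x hx => by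
    rw [hg, Set.indicator_of_notMem]
    simpa [hS] using hx
  let χ : BoundaryFun Ω := ⟨g, hf.indicator hSm, fun x => by
    by_cases hx : ∃ k : ℤ, A (k * N) x ∈ J m
    · obtain ⟨k, hk⟩ := hx
      rw [hgS k x hk]
      exact ψ.2.2 _
    · push Not at hx
      rw [hgN x hx, norm_zero]
      exact zero_le_one⟩
  refine ⟨Q χ, hψ m le_rfl χ fun x hx => ?_, N, hN, ?_⟩
  · have := hgS 0 x (by simpa [h.zero] using hx)
    simpa [h.zero] using this
  · change T^[N] (Q χ) = Q χ
    rw [h.iterate_apply]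
    congr 1
    refine Subtype.ext (funext fun x => ?_)
    change g (A N x) = g x
    have hsh : ∀ k : ℤ, A (k * N) (A N x) = A ((k + 1) * N) x := fun k => by
      rw [← h.add]
      congr 1
      ring
    by_cases hx : ∃ k : ℤ, A (k * N) x ∈ J m
    · obtain ⟨k, hk⟩ := hx
      have hk' : A ((k - 1) * N) (A N x) = A (k * N) x := by rw [hsh, sub_add_cancel]
      rw [hgS k x hk, hgS (k - 1) (A N x) (hk'.symm ▸ hk), hk']
    · push Not at hx
      rw [hgN x hx, hgN _ fun k => hsh k ▸ hx _]

end WanderingModel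

/-! ### The circle parametrized by the real line -/

/-- The point `(i - t) / (i + t)` of the unit circle, the image of `t` under the inverse of the
Cayley transform. -/
noncomputable def circlePt (t : ℝ) : ℂ := (I - t) / (I + t)

/-- The real coordinate of a point of the unit circle, a left inverse of `circlePt`. -/
noncomputable def lineCoord (ζ : ℂ) : ℝ := (I * (1 - ζ) / (1 + ζ)).re

theorem I_add_ofReal_ne_zero (t : ℝ) : I + (t : ℂ) ≠ 0 := fun h => by
  simpa using congrArg Complex.im h

theorem normSq_I_add_ofReal (t : ℝ) : ‖I + (t : ℂ)‖ ^ 2 = 1 + t ^ 2 := by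
  rw [Complex.sq_norm, Complex.normSq_apply]
  simp
  ring

theorem norm_circlePt (t : ℝ) : ‖circlePt t‖ = 1 := by
  rw [circlePt, norm_div, div_eq_one_iff_eq (norm_ne_zero_iff.2 (I_add_ofReal_ne_zero t)),
    ← sq_eq_sq₀ (norm_nonneg _) (norm_nonneg _), Complex.sq_norm, Complex.sq_norm,
    Complex.normSq_apply, Complex.normSq_apply]
  simp

theorem continuous_circlePt : Continuous circlePt :=
  Continuous.div (by fun_prop) (by fun_prop) I_add_ofReal_ne_zero

theorem lineCoord_circlePt (t : ℝ) : lineCoord (circlePt t) = t := by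
  have h := I_add_ofReal_ne_zero t
  have h1 : 1 - (I - (t : ℂ)) / (I + t) = 2 * t / (I + t) := by field_simp; ring
  have h2 : 1 + (I - (t : ℂ)) / (I + t) = 2 * I / (I + t) := by field_simp; ring
  have h3 : I * (1 - circlePt t) / (1 + circlePt t) = t := by
    rw [circlePt, h1, h2]
    field_simp
  rw [lineCoord, h3, ofReal_re]

theorem measurable_lineCoord : Measurable lineCoord := by
  unfold lineCoord
  fun_prop

theorem circleMap_two_mul_arctan (t : ℝ) : circleMap 0 1 (2 * Real.arctan t) = circlePt t := by
  have hc := Real.cos_sq_arctan t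
  have hs : Real.sin (Real.arctan t) = t * Real.cos (Real.arctan t) := by
    rw [Real.sin_arctan, Real.cos_arctan]
    ring
  have hpos : (1 + t ^ 2 : ℝ) ≠ 0 := by positivity
  have hc' : Real.cos (Real.arctan t) ^ 2 * (1 + t ^ 2) = 1 := by
    rw [hc]
    field_simp
  rw [circlePt, eq_div_iff (I_add_ofReal_ne_zero t), circleMap_zero, ofReal_one, one_mul,
    exp_mul_I, ← ofReal_cos, ← ofReal_sin, Real.cos_two_mul, Real.sin_two_mul, hs]
  generalize Real.cos (Real.arctan t) = c at hc'
  apply Complex.ext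
  · simp [pow_two]
    ring
  · simp [pow_two]
    linear_combination 2 * hc'

/-- Change of variables `t = tan (θ / 2)`. -/
theorem circleAverage_eq_integral_circlePt (g : ℂ → ℂ) :
    Real.circleAverage g 0 1 = ∫ t : ℝ, (Real.pi * (1 + t ^ 2))⁻¹ • g (circlePt t) := by
  have himg : (fun t : ℝ => 2 * Real.arctan t) '' Set.univ = Set.Ioo (-Real.pi) Real.pi := by
    ext x
    constructor
    · rintro ⟨t, -, rfl⟩
      have h1 := Real.neg_pi_div_two_lt_arctan t
      have h2 := Real.arctan_lt_pi_div_two t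
      constructor <;> dsimp only <;> linarith
    · rintro ⟨h1, h2⟩
      refine ⟨Real.tan (x / 2), trivial, ?_⟩
      dsimp only
      rw [Real.arctan_tan (by linarith) (by linarith)]
      ring
  have hinj : Set.InjOn (fun t : ℝ => 2 * Real.arctan t) Set.univ := fun a _ b _ h =>
    Real.arctan_injective (mul_left_cancel₀ two_ne_zero h)
  have key := integral_image_eq_integral_abs_deriv_smul (f := fun t : ℝ => 2 * Real.arctan t)
    MeasurableSet.univ
    (fun t _ => ((Real.hasDerivAt_arctan t).const_mul 2).hasDerivWithinAt) hinj
    (fun θ => g (circleMap 0 1 θ))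
  rw [himg, Measure.restrict_univ] at key
  -- The substitution covers angles in `(-π, π)`, whereas the circle average runs over a period
  -- starting at 0.
  have hper := (periodic_circleMap 0 1).comp g
  rw [Real.circleAverage, show (2 * Real.pi : ℝ) = 0 + 2 * Real.pi by ring,
    (show Function.Periodic (fun θ => g (circleMap 0 1 θ)) (2 * Real.pi) from
      hper).intervalIntegral_add_eq 0 (-Real.pi), show -Real.pi + 2 * Real.pi = Real.pi by ring,
    intervalIntegral.integral_of_le (by linarith [Real.pi_pos]), integral_Ioc_eq_integral_Ioo, key,
    ← integral_smul]
  refine integral_congr_ae (Eventually.of_forall fun t => ?_)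
  dsimp only
  rw [circleMap_two_mul_arctan, smul_smul]
  congr 1
  have hpos : (0 : ℝ) < 1 + t ^ 2 := by positivity
  have := Real.pi_pos
  rw [abs_of_pos (by positivity)]
  field_simp
  ring

/-! ### Poisson integrals of functions on the real line -/

/-- The Poisson kernel of the unit disc with respect to Lebesgue measure on the real line. -/
noncomputable def lineKernel (z : ℂ) (t : ℝ) : ℝ :=
  (Real.pi * (1 + t ^ 2))⁻¹ * poissonKernel 0 z (circlePt t)

/-- The Poisson integral on the disc of a function on the real line. -/
noncomputable def poissonFun (ψ : ℝ → ℂ) (z : ℂ) : ℂ := ∫ t, lineKernel z t • ψ t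

theorem circleAverage_poissonKernel_eq (g : ℂ → ℂ) (z : ℂ) :
    Real.circleAverage (poissonKernel 0 z • g) 0 1 = poissonFun (g ∘ circlePt) z := by
  rw [circleAverage_eq_integral_circlePt]
  refine integral_congr_ae (Eventually.of_forall fun t => ?_)
  simp only [lineKernel, Pi.smul_apply', Function.comp_apply, smul_smul]

theorem poissonFun_eq_circleAverage (ψ : ℝ → ℂ) (z : ℂ) :
    poissonFun ψ z = Real.circleAverage (poissonKernel 0 z • (ψ ∘ lineCoord)) 0 1 := by
  rw [circleAverage_poissonKernel_eq]
  congr 1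
  exact funext fun t => (congrArg ψ (lineCoord_circlePt t)).symm

theorem lineKernel_nonneg {z : ℂ} (hz : ‖z‖ < 1) (t : ℝ) : 0 ≤ lineKernel z t := by
  have := Real.pi_pos
  have h : 0 ≤ 1 - ‖z‖ ^ 2 := by nlinarith [norm_nonneg z]
  rw [lineKernel, poissonKernel_def, sub_zero, sub_zero, norm_circlePt, one_pow]
  positivity

theorem lineKernel_zero (t : ℝ) : lineKernel 0 t = (Real.pi * (1 + t ^ 2))⁻¹ := by
  simp [lineKernel, poissonKernel_def, norm_circlePt]

/-- Harnack's bound for the Poisson kernel. The factor does not depend on `t` and is bounded for `z`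
in a compact subset of the disc. -/
theorem lineKernel_le {z : ℂ} (hz : ‖z‖ < 1) (t : ℝ) :
    lineKernel z t ≤ (1 + ‖z‖) / (1 - ‖z‖) * lineKernel 0 t := by
  have := Real.pi_pos
  have h := re_herglotzRieszKernel_le (c := 0) (R := 1) (z := circlePt t) (w := z)
    (by simp [norm_circlePt]) (by simpa using hz)
  rw [sub_zero, sub_zero] at h
  rw [lineKernel_zero, mul_comm, lineKernel, poissonKernel_eq_re_herglotzRieszKernel,
    Function.comp_apply, herglotzRieszKernel_def, sub_zero, sub_zero]
  gcongr

theorem continuous_lineKernel {z : ℂ} (hz : ‖z‖ < 1) : Continuous (lineKernel z) := by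
  have h : ∀ t, circlePt t - z ≠ 0 := fun t h0 => by
    have := norm_circlePt t
    rw [sub_eq_zero.1 h0] at this
    linarith
  have hc := continuous_circlePt
  have := Real.pi_pos
  unfold lineKernel
  simp only [poissonKernel_def, sub_zero]
  refine Continuous.mul (Continuous.inv₀ (by fun_prop) fun t => by positivity)
    (Continuous.div (by fun_prop) (by fun_prop) fun t => ?_)
  exact pow_ne_zero _ (norm_ne_zero_iff.2 (h t))

theorem integrable_lineKernel {z : ℂ} (hz : ‖z‖ < 1) : Integrable (lineKernel z) := by
  have h0 : Integrable (lineKernel 0) := by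
    have : lineKernel 0 = fun t : ℝ => Real.pi⁻¹ * (1 + t ^ 2)⁻¹ :=
      funext fun t => by rw [lineKernel_zero, mul_inv]
    rw [this]
    exact integrable_inv_one_add_sq.const_mul _
  refine (h0.const_mul ((1 + ‖z‖) / (1 - ‖z‖))).mono'
    (continuous_lineKernel hz).aestronglyMeasurable (Eventually.of_forall fun t => ?_)
  rw [Real.norm_of_nonneg (lineKernel_nonneg hz t)]
  exact lineKernel_le hz t

/-- Poisson integral formula for complex valued harmonic functions on the unit disc. -/
theorem circleAverage_poissonKernel_smul_of_harmonicOnNhd {f : ℂ → ℂ}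
    (hf : HarmonicOnNhd f (closedBall 0 1)) {z : ℂ} (hz : ‖z‖ < 1) :
    Real.circleAverage (poissonKernel 0 z • f) 0 1 = f z := by
  have hzb : z ∈ ball (0 : ℂ) 1 := by simpa using hz
  have hint : CircleIntegrable (poissonKernel 0 z • f) 0 1 := by
    refine ContinuousOn.circleIntegrable zero_le_one (ContinuousOn.smul ?_
      (hf.continuousOn.mono sphere_subset_closedBall))
    rw [poissonKernel_eq_re_herglotzRieszKernel]
    have := continuousOn_herglotzRieszKernel_sphere hzb
    rw [abs_one] at this
    exact continuous_re.comp_continuousOn this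
  -- Reduction to the real-valued Poisson formula, applied to the real and imaginary parts.
  have key : ∀ L : ℂ →L[ℝ] ℝ, L (Real.circleAverage (poissonKernel 0 z • f) 0 1) = L (f z) := by
    intro L
    rw [← L.circleAverage_comp_comm hint]
    have h := HarmonicOnNhd.circleAverage_poissonKernel_smul (hf.comp_CLM L) hzb
    rw [Function.comp_apply] at h
    rw [← h]
    congr 1
    funext ζ
    exact L.map_smul _ _
  exact Complex.ext (key reCLM) (key imCLM)

theorem poissonFun_one {z : ℂ} (hz : ‖z‖ < 1) : poissonFun (fun _ => 1) z = 1 := by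
  have h := circleAverage_poissonKernel_smul_of_harmonicOnNhd (f := fun _ => 1)
    (fun _ _ => harmonicAt_const 1) hz
  rwa [circleAverage_poissonKernel_eq] at h

theorem integral_lineKernel {z : ℂ} (hz : ‖z‖ < 1) : ∫ t, lineKernel z t = 1 := by
  have h := poissonFun_one hz
  simp only [poissonFun, Complex.real_smul, mul_one] at h
  rw [integral_complex_ofReal] at h
  exact_mod_cast h

theorem integrable_lineKernel_smul {z : ℂ} (hz : ‖z‖ < 1) (ψ : BoundaryFun ℝ) :
    Integrable fun t => lineKernel z t • ψ.1 t :=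
  (integrable_lineKernel hz).smul_bdd 1 ψ.2.1.aestronglyMeasurable
    (Eventually.of_forall ψ.2.2)

theorem norm_poissonFun_le {z : ℂ} (hz : ‖z‖ < 1) (ψ : BoundaryFun ℝ) :
    ‖poissonFun ψ.1 z‖ ≤ 1 := by
  refine le_of_le_of_eq ?_ (integral_lineKernel hz)
  refine norm_integral_le_of_norm_le (integrable_lineKernel hz) (Eventually.of_forall fun t => ?_)
  rw [norm_smul, Real.norm_of_nonneg (lineKernel_nonneg hz t)]
  exact mul_le_of_le_one_right (lineKernel_nonneg hz t) (ψ.2.2 t)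

/-- The Poisson kernel is the real part of the Herglotz–Riesz kernel `H`, so the integral of `P ψ`
is half the sum of the integral of `H ψ`, which is holomorphic, and the conjugate of the integral of
`H ψ̄`, which is antiholomorphic. -/
theorem harmonicOnNhd_poissonFun (ψ : BoundaryFun ℝ) :
    HarmonicOnNhd (poissonFun ψ.1) (ball 0 1) := by
  set Ψ : ℂ → ℂ := ψ.1 ∘ lineCoord with hΨ
  have hΨm : Measurable Ψ := ψ.2.1.comp measurable_lineCoord
  have hint : ∀ Φ : ℂ → ℂ, Measurable Φ → (∀ x, ‖Φ x‖ ≤ 1) → CircleIntegrable Φ 0 1 := by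
    intro Φ hΦ hb
    rw [CircleIntegrable, intervalIntegrable_iff]
    exact Measure.integrableOn_of_bounded (M := 1) measure_Ioc_lt_top.ne
      (hΦ.comp (continuous_circleMap 0 1).measurable).aestronglyMeasurable
      (Eventually.of_forall fun x => hb _)
  have hi1 := hint Ψ hΨm fun x => ψ.2.2 _
  have hi2 := hint (fun x => conj (Ψ x)) (continuous_conj.measurable.comp hΨm) fun x => by
    rw [RCLike.norm_conj]
    exact ψ.2.2 _
  have ha1 := analyticOnNhd_circleAverage_herglotzRieszKernel_smul hi1
  have ha2 := analyticOnNhd_circleAverage_herglotzRieszKernel_smul hi2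
  set G₁ := fun w => Real.circleAverage (fun ζ => herglotzRieszKernel 0 w ζ • Ψ ζ) 0 1
  set G₂ := fun w => Real.circleAverage (fun ζ => herglotzRieszKernel 0 w ζ • conj (Ψ ζ)) 0 1
  have hformula : ∀ w ∈ ball (0 : ℂ) 1,
      (1 / 2 : ℝ) • (G₁ w + conjCLE (G₂ w)) = poissonFun ψ.1 w := by
    intro w hw
    have hk : ContinuousOn (herglotzRieszKernel 0 w) (sphere 0 |1|) :=
      continuousOn_herglotzRieszKernel_sphere hw
    have j1 : CircleIntegrable (fun ζ => herglotzRieszKernel 0 w ζ • Ψ ζ) 0 1 :=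
      hi1.continuousOn_smul hk
    have j2 : CircleIntegrable (fun ζ => herglotzRieszKernel 0 w ζ • conj (Ψ ζ)) 0 1 :=
      hi2.continuousOn_smul hk
    have j3 : CircleIntegrable
        ((conjCLE : ℂ →L[ℝ] ℂ) ∘ fun ζ => herglotzRieszKernel 0 w ζ • conj (Ψ ζ)) 0 1 := by
      simp only [CircleIntegrable, intervalIntegrable_iff] at j2 ⊢
      exact (conjCLE : ℂ →L[ℝ] ℂ).integrable_comp j2
    have e2 := (conjCLE : ℂ →L[ℝ] ℂ).circleAverage_comp_comm j2
    have e3 : conjCLE (G₂ w) = Real.circleAverage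
        ((conjCLE : ℂ →L[ℝ] ℂ) ∘ fun ζ => herglotzRieszKernel 0 w ζ • conj (Ψ ζ)) 0 1 := e2.symm
    rw [e3, ← Real.circleAverage_add j1 j3, ← Real.circleAverage_smul, poissonFun_eq_circleAverage]
    congr 1
    funext ζ
    simp only [Pi.smul_apply, Pi.smul_apply', Pi.add_apply, Function.comp_apply,
      poissonKernel_eq_re_herglotzRieszKernel]
    change (1 / 2 : ℝ) • (herglotzRieszKernel 0 w ζ • Ψ ζ +
      conj (herglotzRieszKernel 0 w ζ • conj (Ψ ζ))) = (herglotzRieszKernel 0 w ζ).re • Ψ ζ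
    apply Complex.ext
    · simp
      ring
    · simp
      ring
  intro w hw
  refine (harmonicAt_congr_nhds ?_).1
    (((ha1 w hw).harmonicAt.add ((ha2 w hw).harmonicAt.comp_CLM (conjCLE : ℂ →L[ℝ] ℂ))).const_smul
      (c := (1 / 2 : ℝ)))
  filter_upwards [isOpen_ball.mem_nhds hw] with x hx
  exact hformula x hx

/-! ### Density and continuity of Poisson integrals -/

/-- The extension by zero of a function on the disc agrees with it on the disc. -/
theorem extend_coe_apply (f : 𝔻 → ℂ) {z : ℂ} (hz : ‖z‖ < 1) :
    Function.extend ((↑) : 𝔻 → ℂ) f 0 z = f (UnitDisc.mk z hz) := by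
  have h := UnitDisc.coe_injective.extend_apply f 0 (UnitDisc.mk z hz)
  rwa [UnitDisc.coe_mk] at h

theorem eventually_extend_coe_eq {f : 𝔻 → ℂ} {g : ℂ → ℂ} (h : ∀ z : 𝔻, f z = g z) {z : ℂ}
    (hz : ‖z‖ < 1) : Function.extend ((↑) : 𝔻 → ℂ) f 0 =ᶠ[𝓝 z] g := by
  filter_upwards [isOpen_ball.mem_nhds (show z ∈ ball (0 : ℂ) 1 by simpa using hz)] with w hw
  have hw' : ‖w‖ < 1 := by simpa using hw
  rw [extend_coe_apply f hw', h, UnitDisc.coe_mk]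

/-- The Poisson integral of a bounded measurable function on the real line, as an element of
`Har`. -/
noncomputable def poissonHar (ψ : BoundaryFun ℝ) : Har :=
  ⟨⟨fun z : 𝔻 => poissonFun ψ.1 z, (harmonicOnNhd_poissonFun ψ).continuousOn.comp_continuous
      UnitDisc.continuous_coe fun z => by simpa using z.norm_lt_one⟩,
    fun _ hz => (harmonicAt_congr_nhds (eventually_extend_coe_eq (fun _ => rfl)
      (by simpa using hz))).2 (harmonicOnNhd_poissonFun ψ _ hz),
    fun z => norm_poissonFun_le z.norm_lt_one ψ⟩

theorem poissonHar_apply (ψ : BoundaryFun ℝ) (z : 𝔻) :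
    (poissonHar ψ).1 z = poissonFun ψ.1 z := rfl

/-- Poisson integrals depend continuously on the boundary values, with respect to pointwise
convergence almost everywhere. -/
theorem tendsto_poissonHar {φ : ℕ → BoundaryFun ℝ} {ψ : BoundaryFun ℝ}
    (h : ∀ᵐ t, Tendsto (fun m => (φ m).1 t) atTop (𝓝 (ψ.1 t))) :
    Tendsto (fun m => poissonHar (φ m)) atTop (𝓝 (poissonHar ψ)) := by
  have h0 : ‖(0 : ℂ)‖ < 1 := by simp
  -- Convergence at the centre in weighted `L¹` is enough: Harnack's bound carries it to all `z`,
  -- uniformly on compact sets.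
  have hlim : Tendsto (fun m => ∫ t, lineKernel 0 t * ‖(φ m).1 t - ψ.1 t‖) atTop (𝓝 0) := by
    rw [← integral_zero ℝ ℝ (μ := volume)]
    refine tendsto_integral_of_dominated_convergence (fun t => lineKernel 0 t * 2)
      (fun m => ?_) ((integrable_lineKernel h0).mul_const 2)
      (fun m => Eventually.of_forall fun t => ?_) ?_
    · exact ((continuous_lineKernel h0).measurable.mul
        ((φ m).2.1.sub ψ.2.1).norm).aestronglyMeasurable
    · have hk := lineKernel_nonneg h0 t
      rw [Real.norm_of_nonneg (by positivity)]
      have h2 : ‖(φ m).1 t - ψ.1 t‖ ≤ 2 :=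
        (norm_sub_le _ _).trans (by linarith [(φ m).2.2 t, ψ.2.2 t])
      gcongr
    · filter_upwards [h] with t ht
      have := ((ht.sub_const (ψ.1 t)).norm).const_mul (lineKernel 0 t)
      simpa using this
  have hbound : ∀ (m : ℕ) (z : 𝔻), ‖poissonFun (φ m).1 z - poissonFun ψ.1 z‖ ≤
      (1 + ‖(z : ℂ)‖) / (1 - ‖(z : ℂ)‖) * ∫ t, lineKernel 0 t * ‖(φ m).1 t - ψ.1 t‖ := by
    intro m z
    have hz := z.norm_lt_one
    rw [poissonFun, poissonFun, ← integral_sub (integrable_lineKernel_smul hz _)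
      (integrable_lineKernel_smul hz _), ← integral_const_mul]
    refine norm_integral_le_of_norm_le (Integrable.const_mul ?_ _)
      (Eventually.of_forall fun t => ?_)
    · refine ((integrable_lineKernel h0).smul_bdd (f := fun t => ‖(φ m).1 t - ψ.1 t‖) 2
        ((φ m).2.1.sub ψ.2.1).norm.aestronglyMeasurable (Eventually.of_forall fun t => ?_))
      rw [norm_norm]
      exact (norm_sub_le _ _).trans (by linarith [(φ m).2.2 t, ψ.2.2 t])
    · rw [← smul_sub, norm_smul, Real.norm_of_nonneg (lineKernel_nonneg hz t), ← mul_assoc]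
      exact mul_le_mul_of_nonneg_right (lineKernel_le hz t) (norm_nonneg _)
  rw [Topology.IsInducing.subtypeVal.tendsto_nhds_iff,
    ContinuousMap.tendsto_iff_forall_isCompact_tendstoUniformlyOn]
  intro K hK
  have hcont : Continuous fun z : 𝔻 => (1 + ‖(z : ℂ)‖) / (1 - ‖(z : ℂ)‖) := by
    have := UnitDisc.continuous_coe
    exact Continuous.div (by fun_prop) (by fun_prop) fun z => (sub_pos.2 z.norm_lt_one).ne'
  obtain ⟨C, hC⟩ := hK.bddAbove_image hcont.continuousOn
  have hlim' := hlim.const_mul C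
  rw [mul_zero] at hlim'
  rw [Metric.tendstoUniformlyOn_iff]
  intro ε hε
  filter_upwards [hlim'.eventually (gt_mem_nhds hε)] with m hm z hz
  rw [dist_comm, dist_eq_norm]
  refine ((hbound m z).trans ?_).trans_lt hm
  exact mul_le_mul_of_nonneg_right (hC (Set.mem_image_of_mem _ hz))
    (integral_nonneg fun t => mul_nonneg (lineKernel_nonneg h0 t) (norm_nonneg _))

/-- The dilations of the disc with ratio in the unit interval. -/
noncomputable def dilation : C(unitInterval × 𝔻, 𝔻) where
  toFun p := UnitDisc.mk ((p.1 : ℝ) * (p.2 : ℂ)) (by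
    rw [norm_mul, Complex.norm_real, Real.norm_of_nonneg p.1.2.1]
    exact mul_lt_one_of_nonneg_of_lt_one_right p.1.2.2 (norm_nonneg _) p.2.norm_lt_one)
  continuous_toFun := by
    rw [UnitDisc.isEmbedding_coe.continuous_iff]
    have := UnitDisc.continuous_coe
    change Continuous fun p : unitInterval × 𝔻 => ((p.1 : ℝ) : ℂ) * (p.2 : ℂ)
    fun_prop

theorem coe_dilation (r : unitInterval) (z : 𝔻) : (dilation (r, z) : ℂ) = (r : ℝ) * z := rfl

theorem dilate_mem_Har {f : C(𝔻, ℂ)} (hf : f ∈ Har) (r : unitInterval) :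
    (f.comp dilation).curry r ∈ Har := by
  refine ⟨fun z hz => ?_, fun z => hf.2 _⟩
  have hz' : ‖z‖ < 1 := by simpa using hz
  refine (harmonicAt_congr_nhds (eventually_extend_coe_eq
    (g := Function.extend ((↑) : 𝔻 → ℂ) f 0 ∘ fun w => ((r : ℝ) : ℂ) * w) (fun w => ?_) hz')).2 ?_
  · rw [Function.comp_apply, ← coe_dilation, UnitDisc.coe_injective.extend_apply]
    rfl
  · refine harmonicAt_comp (hf.1 _ ?_) (by fun_prop)
    have := (dilation (r, UnitDisc.mk z hz')).norm_lt_one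
    rw [coe_dilation, UnitDisc.coe_mk] at this
    simpa using this

/-- For `r < 1` the dilate `z ↦ f (r z)` is harmonic on a neighbourhood of the closed disc, so it is
the Poisson integral of its own boundary values. -/
theorem exists_poissonHar_eq_dilate (f : Har) {r : unitInterval} (hr : r < 1) :
    ∃ ψ, poissonHar ψ = ⟨_, dilate_mem_Har f.2 r⟩ := by
  have hr0 : (0 : ℝ) ≤ r := r.2.1
  have hr1 : (r : ℝ) < 1 := hr
  set F : ℂ → ℂ := Function.extend ((↑) : 𝔻 → ℂ) f.1 0 ∘ fun w => ((r : ℝ) : ℂ) * w with hF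
  have hmem : ∀ w : ℂ, ‖w‖ ≤ 1 → ‖((r : ℝ) : ℂ) * w‖ < 1 := fun w hw => by
    rw [norm_mul, Complex.norm_real, Real.norm_of_nonneg hr0]
    exact mul_lt_one_of_nonneg_of_lt_one_left hr0 hr1 hw
  have hharm : HarmonicOnNhd F (closedBall 0 1) := fun w hw =>
    harmonicAt_comp (f.2.1 _ (by simpa using hmem w (by simpa using hw))) (by fun_prop)
  refine ⟨⟨F ∘ circlePt, (hharm.continuousOn.comp_continuous continuous_circlePt
    fun t => by simp [norm_circlePt]).measurable, fun t => ?_⟩, ?_⟩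
  · rw [Function.comp_apply, hF, Function.comp_apply,
      extend_coe_apply _ (hmem _ (norm_circlePt t).le)]
    exact f.2.2 _
  · refine Subtype.ext (ContinuousMap.ext fun z => ?_)
    rw [poissonHar_apply, ← circleAverage_poissonKernel_eq,
      circleAverage_poissonKernel_smul_of_harmonicOnNhd hharm z.norm_lt_one, hF,
      Function.comp_apply, extend_coe_apply _ (hmem _ z.norm_lt_one.le)]
    rfl

/-- Every `f` is the limit of its dilates as `r → 1`, so no boundary values of `f` itself are
needed. Currying gives the continuity in `r` for the compact-open topology. -/
theorem denseRange_poissonHar : DenseRange poissonHar := by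
  intro f
  have hcont : Continuous fun r : unitInterval =>
      (⟨_, dilate_mem_Har f.2 r⟩ : Har) :=
    ((f.1.comp dilation).curry.continuous).subtype_mk _
  have h1 : (⟨_, dilate_mem_Har f.2 1⟩ : Har) = f := by
    refine Subtype.ext (ContinuousMap.ext fun z => ?_)
    change f.1 (dilation (1, z)) = f.1 z
    congr 1
    apply UnitDisc.coe_injective
    simp [coe_dilation]
  rw [← h1]
  refine map_mem_closure hcont (s := Set.Iio 1) ?_ fun r hr => ?_
  · rw [closure_Iio' ⟨0, zero_lt_one⟩]
    exact Set.mem_Iic.2 le_rfl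
  · obtain ⟨ψ, hψ⟩ := exists_poissonHar_eq_dilate f hr
    exact ⟨ψ, hψ⟩

/-! ### Affine maps of the half-plane -/

/-- In the half-plane coordinate the kernel takes its classical form, whose behaviour under affine
maps is visible. -/
theorem lineKernel_eq_im_cayley (z : 𝔻) (t : ℝ) :
    lineKernel z t = (cayley z : ℂ).im / (Real.pi * ‖(cayley z : ℂ) - t‖ ^ 2) := by
  have hne : 1 + (z : ℂ) ≠ 0 := z.one_add_coe_ne_zero
  have hIt := I_add_ofReal_ne_zero t
  have hw : (cayley z : ℂ) = I * (1 - (z : ℂ)) / (1 + z) := rfl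
  have him : (cayley z : ℂ).im = (1 - ‖(z : ℂ)‖ ^ 2) / ‖1 + (z : ℂ)‖ ^ 2 := by
    rw [hw, Complex.div_im, ← sub_div, Complex.sq_norm, Complex.sq_norm,
      Complex.normSq_apply (z : ℂ)]
    congr 1
    simp
    ring
  have hsub : circlePt t - z = (1 + z) * ((cayley z : ℂ) - t) / (I + t) := by
    rw [hw, circlePt]
    field_simp
    ring
  have h1 : ‖1 + (z : ℂ)‖ ≠ 0 := norm_ne_zero_iff.2 hne
  have h2 : (1 + t ^ 2 : ℝ) ≠ 0 := by positivity
  rw [lineKernel, poissonKernel_def, sub_zero, sub_zero, norm_circlePt, hsub, him, norm_div,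
    norm_mul, div_pow, mul_pow, normSq_I_add_ofReal]
  field_simp

/-- The half-plane kernel is homogeneous of degree `-1` and invariant under real translations; its
scaling cancels the Jacobian of `t ↦ s t + c`. -/
theorem poissonFun_comp_affine {z z' : 𝔻} {s c : ℝ} (hs : 0 < s)
    (h : (cayley z' : ℂ) = s * cayley z + c) (ψ : ℝ → ℂ) :
    poissonFun ψ z' = poissonFun (fun t => ψ (s * t + c)) z := by
  have hk : ∀ t, lineKernel z t = s * lineKernel z' (s * t + c) := by
    intro t
    rw [lineKernel_eq_im_cayley, lineKernel_eq_im_cayley, h]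
    have e : (s * cayley z + c : ℂ) - ((s * t + c : ℝ) : ℂ) = s * ((cayley z : ℂ) - t) := by
      push_cast
      ring
    rw [e, norm_mul, Complex.norm_real, Real.norm_of_nonneg hs.le]
    simp only [add_im, mul_im, ofReal_re, ofReal_im, zero_mul, add_zero]
    field_simp
  simp only [poissonFun, hk, mul_smul]
  rw [integral_smul, Measure.integral_comp_mul_left (fun t => lineKernel z' (t + c) • ψ (t + c)) s,
    integral_add_right_eq_self (fun t => lineKernel z' t • ψ t) c, smul_smul,
    abs_of_pos (inv_pos.2 hs), mul_inv_cancel₀ hs.ne', one_smul]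

/-! ### Normal forms of hyperbolic and parabolic elements -/

theorem continuous_smul_Har (γ : PSL(2, ℝ)) : Continuous fun f : Har => γ • f :=
  ((ContinuousMap.continuous_precomp (discMap γ⁻¹)).comp continuous_subtype_val).subtype_mk _

theorem coe_cayley_mk_smul (g : SL(2, ℝ)) (z : 𝔻) :
    (cayley ((g : PSL(2, ℝ)) • z) : ℂ) =
      (g 0 0 * cayley z + g 0 1) / (g 1 0 * cayley z + g 1 1) := by
  have h : cayley ((g : PSL(2, ℝ)) • z) = g • cayley z := by
    rw [smul_def, Equiv.apply_symm_apply]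
    rfl
  rw [h]
  exact UpperHalfPlane.coe_specialLinearGroup_apply g _

/-- A conjugate of an element of `PSL(2, ℝ)` whose inverse acts on the half-plane by a nontrivial
affine map has a wandering model, as soon as there is a coordinate `ℓ` on the line, defined almost
everywhere, in which the affine map acts by a translation. -/
theorem wanderingModel_of_coordinate {p τ : PSL(2, ℝ)} {s c : ℝ} (hs : 0 < s)
    (hτ : ∀ z : 𝔻, (cayley (τ⁻¹ • z) : ℂ) = s * cayley z + c) {A : ℤ → ℝ → ℝ}
    (hA : ∀ k, Measurable (A k)) (h1 : ∀ x, A 1 x = s * x + c) (h0 : ∀ x, A 0 x = x)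
    (hadd : ∀ j k x, A (j + k) x = A j (A k x)) {S : Set ℝ} (hS : MeasurableSet S)
    (hSae : ∀ᵐ x, x ∈ S) {ℓ : ℝ → ℝ} (hℓ : Measurable ℓ) {d : ℝ} (hd : d ≠ 0)
    (hℓA : ∀ k, ∀ x ∈ S, ℓ (A k x) = ℓ x + k * d) :
    WanderingModel (fun f : Har => (p * τ * p⁻¹) • f) (fun ψ => p • poissonHar ψ) A
      (fun m => S ∩ {x | |ℓ x| ≤ m}) where
  denseRange := by
    have hsurj : Function.Surjective fun f : Har => p • f := MulAction.surjective p
    exact hsurj.denseRange.comp denseRange_poissonHar (continuous_smul_Har p)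
  measurable := hA
  zero := h0
  add := hadd
  equivariant ψ := by
    rw [mul_smul, inv_smul_smul, mul_smul]
    congr 1
    refine Subtype.ext (ContinuousMap.ext fun z => ?_)
    rw [smul_apply, poissonHar_apply, poissonHar_apply, poissonFun_comp_affine hs (hτ z)]
    congr 1
    exact funext fun t => congrArg ψ.1 (h1 t).symm
  measurableSet m := hS.inter (measurableSet_le hℓ.abs measurable_const)
  tendsto φ ψ h := by
    refine ((continuous_smul_Har p).tendsto _).comp (tendsto_poissonHar ?_)
    filter_upwards [hSae] with x hx
    obtain ⟨m₀, hm₀⟩ := exists_nat_ge |ℓ x|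
    refine tendsto_const_nhds.congr' ?_
    filter_upwards [eventually_ge_atTop m₀] with m hm
    exact (h m ⟨hx, hm₀.trans (Nat.cast_le.2 hm)⟩).symm
  mono m n hmn x hx := ⟨hx.1, le_trans (show |ℓ x| ≤ m from hx.2) (Nat.cast_le.2 hmn)⟩
  wandering m := by
    -- Coordinates of two points of the `m`-th set differ by at most `2 * m`, while `k * N` steps
    -- shift the coordinate by at least `N * |d|`.
    obtain ⟨N, hN⟩ := exists_nat_gt (2 * m / |d|)
    have hd' : 0 < |d| := abs_pos.2 hd
    rw [div_lt_iff₀ hd'] at hN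
    refine ⟨N, ?_, fun k hk x hx hx' => ?_⟩
    · rcases Nat.eq_zero_or_pos N with rfl | h
      · have : (0 : ℝ) ≤ m := m.cast_nonneg
        norm_num at hN
        linarith
      · exact h
    · have e1 : |ℓ x| ≤ m := hx.2
      have e2 : |ℓ (A (k * N) x)| ≤ m := hx'.2
      rw [hℓA _ x hx.1] at e2
      have e3 : |((k * N : ℤ) : ℝ) * d| ≤ 2 * m := by
        have := abs_sub (ℓ x + ((k * N : ℤ) : ℝ) * d) (ℓ x)
        rw [add_sub_cancel_left] at this
        linarith
      have hk1 : (1 : ℝ) ≤ |(k : ℝ)| := by exact_mod_cast Int.one_le_abs hk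
      rw [abs_mul, Int.cast_mul, abs_mul, Int.cast_natCast, Nat.abs_cast] at e3
      have : (N : ℝ) * |d| ≤ |(k : ℝ)| * N * |d| := by
        rw [mul_assoc]
        exact le_mul_of_one_le_left (by positivity) hk1
      linarith

theorem exists_wanderingModel_of_affine {p τ : PSL(2, ℝ)} {s c : ℝ} (hs : 0 < s)
    (hτ : ∀ z : 𝔻, (cayley (τ⁻¹ • z) : ℂ) = s * cayley z + c) (hne : s ≠ 1 ∨ c ≠ 0) :
    ∃ (Q : BoundaryFun ℝ → Har) (A : ℤ → ℝ → ℝ) (J : ℕ → Set ℝ),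
      WanderingModel (fun f : Har => (p * τ * p⁻¹) • f) Q A J := by
  by_cases h1 : s = 1
  · have hc : c ≠ 0 := hne.resolve_left (not_not.2 h1)
    refine ⟨_, fun k x => x + k * c, _, wanderingModel_of_coordinate hs hτ
      (fun k => by fun_prop) (fun x => by simp [h1]) (fun x => by simp)
      (fun j k x => by push_cast; ring) MeasurableSet.univ
      (Eventually.of_forall fun _ => trivial) measurable_id hc fun k x _ => rfl⟩
  · have h1' : 1 - s ≠ 0 := sub_ne_zero.2 (Ne.symm h1)
    set x₀ : ℝ := c / (1 - s) with hx₀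
    refine ⟨_, fun k x => x₀ + s ^ k * (x - x₀), _, wanderingModel_of_coordinate hs hτ
      -- `Real.log` is the logarithm of the absolute value, so one coordinate serves both
      -- half-lines; only the fixed point is excluded.
      (S := {x₀}ᶜ) (ℓ := fun x => Real.log (x - x₀)) (d := Real.log s)
      (fun k => by fun_prop) (fun x => ?_) (fun x => by simp)
      (fun j k x => ?_) (measurableSet_singleton x₀).compl
      (compl_mem_ae_iff.2 (measure_singleton x₀)) (by fun_prop)
      (Real.log_ne_zero_of_pos_of_ne_one hs h1) fun k x hx => ?_⟩
    · rw [zpow_one, hx₀]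
      field_simp
      ring
    · rw [zpow_add₀ hs.ne']
      ring
    · have hx' : x - x₀ ≠ 0 := sub_ne_zero.2 hx
      rw [add_sub_cancel_left, Real.log_mul (zpow_ne_zero _ hs.ne') hx', Real.log_zpow, add_comm]

/-- A matrix in `SL(2, ℝ)` with nonnegative discriminant is conjugate to an upper triangular
matrix. -/
theorem exists_conj_upperTriangular (g : SL(2, ℝ))
    (hg : 0 ≤ (g : Matrix (Fin 2) (Fin 2) ℝ).discr) :
    ∃ p : SL(2, ℝ), (p⁻¹ * g * p) 1 0 = 0 := by
  rw [Matrix.discr_fin_two, Matrix.trace_fin_two, Matrix.det_fin_two] at hg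
  by_cases hc : g 1 0 = 0
  · exact ⟨1, by simpa using hc⟩
  set D : ℝ := (g 0 0 + g 1 1) ^ 2 - 4 * (g 0 0 * g 1 1 - g 0 1 * g 1 0) with hD
  have hsq : √D ^ 2 = D := Real.sq_sqrt hg
  -- A real fixed point of the fractional linear map of `g`; the matrix `p` below sends infinity to
  -- it.
  set x : ℝ := (g 0 0 - g 1 1 + √D) / (2 * g 1 0) with hx
  have hroot : g 1 0 * x ^ 2 + (g 1 1 - g 0 0) * x - g 0 1 = 0 := by
    rw [hx]
    field_simp
    rw [hD] at hsq
    linear_combination hsq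
  obtain ⟨p, hp⟩ : ∃ p : SL(2, ℝ), (p : Matrix (Fin 2) (Fin 2) ℝ) = !![x, -1; 1, 0] :=
    ⟨⟨!![x, -1; 1, 0], by simp [Matrix.det_fin_two]⟩, rfl⟩
  refine ⟨p, ?_⟩
  simp only [Matrix.SpecialLinearGroup.coe_mul, Matrix.SpecialLinearGroup.coe_inv,
    Matrix.adjugate_fin_two, hp, Matrix.mul_apply, Fin.sum_univ_two]
  simp
  linear_combination hroot

theorem exists_wanderingModel {γ : PSL(2, ℝ)} (hγ : IsHyperbolic γ ∨ IsParabolic γ) :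
    ∃ (Q : BoundaryFun ℝ → Har) (A : ℤ → ℝ → ℝ) (J : ℕ → Set ℝ),
      WanderingModel (fun f : Har => γ • f) Q A J := by
  obtain ⟨g, rfl, hg⟩ : ∃ g : SL(2, ℝ), (g : PSL(2, ℝ)) = γ ∧
      ((g : Matrix (Fin 2) (Fin 2) ℝ).IsHyperbolic ∨
        (g : Matrix (Fin 2) (Fin 2) ℝ).IsParabolic) := by
    rcases hγ with ⟨g, h1, h2⟩ | ⟨g, h1, h2⟩
    exacts [⟨g, h1, Or.inl h2⟩, ⟨g, h1, Or.inr h2⟩]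
  obtain ⟨p, hp⟩ := exists_conj_upperTriangular g
    (hg.elim (fun h => le_of_lt h) fun h => h.2.ge)
  set τ : SL(2, ℝ) := p⁻¹ * g * p with hτ
  have hconj : (g : PSL(2, ℝ)) = (p : PSL(2, ℝ)) * (τ : PSL(2, ℝ)) * (p : PSL(2, ℝ))⁻¹ := by
    have : g = p * τ * p⁻¹ := by rw [hτ]; group
    rw [this]
    rfl
  have hdet : τ 0 0 * τ 1 1 = 1 := by
    have := τ.det_coe
    rwa [Matrix.det_fin_two, hp, mul_zero, sub_zero] at this
  have hd : τ 1 1 ≠ 0 := right_ne_zero_of_mul_eq_one hdet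
  have ha : τ 0 0 ≠ 0 := left_ne_zero_of_mul_eq_one hdet
  have hτg : (τ : Matrix (Fin 2) (Fin 2) ℝ).IsHyperbolic ∨
      (τ : Matrix (Fin 2) (Fin 2) ℝ).IsParabolic := by
    have e : (τ : Matrix (Fin 2) (Fin 2) ℝ) = (p : GL (Fin 2) ℝ).val⁻¹ *
        (g : Matrix (Fin 2) (Fin 2) ℝ) * (p : GL (Fin 2) ℝ).val := by
      rw [← Matrix.coe_units_inv, hτ]
      rfl
    rwa [e, Matrix.isHyperbolic_conj'_iff, Matrix.isParabolic_conj'_iff]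
  rw [hconj]
  -- For `τ = (a b; 0 d)` with `a d = 1`, the inverse acts by `w ↦ (d w - b) / a = d² w - b d`.
  refine exists_wanderingModel_of_affine (s := τ 1 1 ^ 2) (c := -(τ 0 1 * τ 1 1)) (by positivity)
    (fun z => ?_) ?_
  · change (cayley (((τ⁻¹ : SL(2, ℝ)) : PSL(2, ℝ)) • z) : ℂ) = _
    rw [coe_cayley_mk_smul]
    have hac : (τ 0 0 : ℂ) ≠ 0 := by exact_mod_cast ha
    have hdetc : (τ 0 0 : ℂ) * τ 1 1 = 1 := by exact_mod_cast hdet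
    simp only [Matrix.SpecialLinearGroup.SL2_inv_expl, Matrix.cons_val_zero,
      Matrix.cons_val_one, Matrix.cons_val_fin_one, Matrix.cons_val', hp]
    push_cast
    rw [neg_zero, zero_mul, zero_add, div_eq_iff hac]
    linear_combination (-(τ 1 1 : ℂ) * cayley z + τ 0 1) * hdetc
  -- A trivial affine map would force `τ` to be scalar, hence neither hyperbolic (its discriminant
  -- vanishes) nor parabolic.
  · by_contra! hcon
    obtain ⟨h1, h2⟩ := hcon
    have hb : τ 0 1 = 0 := (mul_eq_zero.1 (neg_eq_zero.1 h2)).resolve_right hd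
    have hae : τ 0 0 = τ 1 1 := mul_right_cancel₀ hd ((hdet.trans (h1.symm.trans (sq _))))
    have hdisc : (τ : Matrix (Fin 2) (Fin 2) ℝ).discr = 0 := by
      rw [Matrix.discr_fin_two, Matrix.trace_fin_two, Matrix.det_fin_two, hp, hae]
      ring
    rcases hτg with h | h
    · exact h.ne' hdisc
    · refine h.1 ⟨τ 0 0, ?_⟩
      ext i j
      fin_cases i <;> fin_cases j <;> simp [hb, hp, hae]

/-- The constant functions in `Har`. -/
noncomputable def constHar (a : ℂ) (ha : ‖a‖ ≤ 1) : Har :=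
  ⟨ContinuousMap.const 𝔻 a, fun _ hz => (harmonicAt_congr_nhds (eventually_extend_coe_eq
    (g := fun _ => a) (fun _ => rfl) (by simpa using hz))).2 (harmonicAt_const a), fun _ => ha⟩

theorem isDevaneyChaotic_smul {γ : PSL(2, ℝ)} (hγ : IsHyperbolic γ ∨ IsParabolic γ)
    (m : MetricSpace Har) (hm : m.toUniformSpace.toTopologicalSpace = harTopology) :
    @IsDevaneyChaotic Har m (fun f => γ • f) := by
  obtain ⟨Q, A, J, h⟩ := exists_wanderingModel hγ
  have hcont : Continuous[harTopology, harTopology] fun f : Har => γ • f := continuous_smul_Har γ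
  have htr : ∀ U V : Set Har, IsOpen[harTopology] U → U.Nonempty → IsOpen[harTopology] V →
      V.Nonempty → ∃ n : ℕ, 0 < n ∧ ((fun f : Har => γ • f)^[n] '' U ∩ V).Nonempty :=
    fun U V hU hUne hV hVne => h.transitive hU hUne hV hVne
  have hper : @Dense _ harTopology (Function.periodicPts fun f : Har => γ • f) :=
    h.dense_periodicPts
  -- Continuity, transitivity and density of periodic points depend only on the topology, so they
  -- transfer to the given metric; only sensitivity uses the distance.
  rw [← hm] at hcont htr hper
  exact ⟨hcont, htr, hper, sensitiveDependence_of_transitive hcont htr hper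
    (q₀ := constHar 0 (by simp)) (q₁ := constHar 1 (by simp)) rfl rfl fun h01 =>
      zero_ne_one (α := ℂ) (congrArg (fun f : Har => f.1 0) h01)⟩

end HarDisc

theorem mainTheorem2 (γ : PSL(2, ℝ)) (hγ : HarDisc.IsHyperbolic γ ∨ HarDisc.IsParabolic γ)
    (m : MetricSpace HarDisc.Har)
    (hm : m.toUniformSpace.toTopologicalSpace = HarDisc.harTopology) :
    @HarDisc.IsDevaneyChaotic HarDisc.Har m (fun f => γ • f) := by
  exact HarDisc.isDevaneyChaotic_smul hγ m hm
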